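/- Let $\lambda = 2\cos(\pi/5)$, let $H_5 \subset SL(2,\mathbb{Z}[\lambda])$ be the group generated by $S=\begin{pmatrix}0&1\\-1&0\end{pmatrix}$ and $T=\begin{pmatrix}1&\lambda\\0&1\end{pmatrix}$, let $Z=\{\pm I\}$, and let $G_5 = H_5/Z$. For $\pi \in \mathbb{Z}[\lambda]$ put $H(\pi)=\{A\in H_5 : A\equiv I \pmod{\pi}\}$ and $G(\pi) = H(\pi)Z/Z$. A subgroup $K$ of $G_5$ is called a congruence subgroup if $G(\pi)\subseteq K$ for some nonzero $\pi\in\mathbb{Z}[\lambda]$. The cusps of $K$ are the points of $\mathbb{R}\cup\{\infty\}$ fixed by a parabolic element of $K$; the width of a cusp $x$ is the smallest positive integer $w$ such that $T^w$ is conjugate in $G_5$ to an element of $K$ fixing $x$; the geometric level of $K$ is the least common multiple of the widths of its cusps. Proposition 5.1. Let $K$ be a subgroup of finite index of $G_5$ with geometric level $m$. (i) If $m\not\equiv 0 \pmod 4$, then $K$ is a congruence subgroup if and only if $G(m)\subseteq K$. (ii) If $4\mid m$, then $K$ is a congruence subgroup if and only if $G(2m)\subseteq K$. -/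

import Mathlib

open Matrix

noncomputable section

namespace HeckeFive

/-- The real number `λ = 2 cos (π / 5)`. -/
def lam : ℝ := 2 * Real.cos (Real.pi / 5)

/-- The ring `ℤ[λ]`, as a subring of `ℝ`. -/
abbrev ZLam : Type := Algebra.adjoin ℤ ({lam} : Set ℝ)

/-- The element `λ` of `ℤ[λ]`. -/
def lamZ : ZLam := ⟨lam, Algebra.subset_adjoin rfl⟩

/-- The group `SL(2, ℤ[λ])`. -/
abbrev SL2ZLam : Type := SpecialLinearGroup (Fin 2) ZLam

/-- The matrix `T = (1, λ; 0, 1)`. -/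
def matT : SL2ZLam := ⟨!![1, lamZ; 0, 1], by simp [Matrix.det_fin_two]⟩

/-- The matrix `S = (0, 1; -1, 0)`. -/
def matS : SL2ZLam := ⟨!![0, 1; -1, 0], by simp [Matrix.det_fin_two]⟩

/-- The homogeneous Hecke group `H₅`, generated by `S` and `T`. -/
def H5 : Subgroup SL2ZLam := Subgroup.closure {matS, matT}

/-- The subgroup `Z = {I, -I}` of `H₅`. -/
def Z : Subgroup H5 where
  carrier := {A | (A : SL2ZLam) = 1 ∨ (A : SL2ZLam) = -1}
  one_mem' := Or.inl rfl
  mul_mem' := by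
    rintro a b (ha | ha) (hb | hb) <;>
      simp only [Set.mem_ofPred_eq, Subgroup.coe_mul, ha, hb] <;> simp
  inv_mem' := by
    rintro a (ha | ha)
    · left; simp [ha]
    · right
      rw [Subgroup.coe_inv, ha]
      exact inv_eq_of_mul_eq_one_right (by simp)

instance : Z.Normal where
  conj_mem := by
    rintro a (ha | ha) g
    · left; simp [ha]
    · right; simp [ha]

/-- The inhomogeneous Hecke group `G₅ = H₅ / Z`. -/
abbrev G5 : Type := H5 ⧸ Z

/-- The projection `H₅ → G₅`, which identifies a matrix with its negative. -/
def proj : H5 →* G5 := QuotientGroup.mk' Z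

/-- The element `T` of `H₅`. -/
def T : H5 := ⟨matT, Subgroup.subset_closure (by simp)⟩

/-- The principal congruence subgroup `H(π)`: the matrices of `H₅` that are congruent to the
identity modulo the ideal `(π)` of `ℤ[λ]`, entry by entry. -/
def H (π : ZLam) : Subgroup H5 :=
  (SpecialLinearGroup.map (n := Fin 2) (Ideal.Quotient.mk (Ideal.span {π}))).ker.comap H5.subtype

/-- The principal congruence subgroup `G(π) = H(π)Z / Z` of `G₅`. -/
def G (π : ZLam) : Subgroup G5 := (H π).map proj

/-- `K ≤ G₅` is a congruence subgroup if it contains `G(π)` for some nonzero `π ∈ ℤ[λ]`. -/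
def IsCongruence (K : Subgroup G5) : Prop := ∃ π : ZLam, π ≠ 0 ∧ G π ≤ K

/-- The embedding of `H₅` in `GL(2, ℝ)`, through which `H₅` acts on `ℝ ∪ {∞}` by fractional linear
transformations. -/
def toGL : H5 →* GL (Fin 2) ℝ := (SpecialLinearGroup.mapGL ℝ).comp H5.subtype

/-- `x ∈ ℝ ∪ {∞}` is a cusp of `K ≤ G₅`: it is fixed by a parabolic element of `K`
(that is, by a parabolic matrix in the preimage of `K` in `H₅`). -/
def IsCuspOf (K : Subgroup G5) (x : OnePoint ℝ) : Prop := IsCusp x ((K.comap proj).map toGL)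

/-- `w` is the width of `x` with respect to `K`: the smallest positive integer `m` such that `T ^ m`
is conjugate in `G₅` to an element of `K` that fixes `x`. -/
def IsWidth (K : Subgroup G5) (x : OnePoint ℝ) (w : ℕ) : Prop :=
  IsLeast {m : ℕ | 0 < m ∧
    ∃ A : H5, proj A ∈ K ∧ toGL A • x = x ∧ IsConj (proj T ^ m) (proj A)} w

/-- The geometric level of `K`: the least common multiple of the widths of the cusps of `K`
(with value `0` if they have no positive common multiple). -/
def geometricLevel (K : Subgroup G5) : ℕ :=
  sInf {n : ℕ | 0 < n ∧ ∀ (x : OnePoint ℝ) (w : ℕ), IsCuspOf K x → IsWidth K x w → w ∣ n}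

end HeckeFive

end

noncomputable section

namespace HeckeFive

/-! ### The ring `ℤ[λ]` -/

/-! Everything is lifted to `H5`. Let N(m) be the normal closure of T^m there. If m is the geometric
level of K, every conjugate of T^m lies in the preimage of K, so that preimage contains N(m)
(`N_geometricLevel_le`). This uses that g T^w g⁻¹ depends only on the cusp g∞, because upper
triangular elements of H₅ have diagonal ±1 and commute with T.

A nonzero π divides some integer n ≠ 0, so a congruence group also contains the image of H(nM). It
remains to prove H(M) ≤ N(m) H(nM) for all n ≠ 0, with M = m if 4 ∤ m and M = 2m if 4 ∣ m
(`H_le_sup_mul`, `H_two_mul_le_sup_mul`).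

One descends prime by prime. If p ∣ M, then 1 + MX ↦ X mod p embeds H(M)/H(pM) into the additive
group of trace-zero matrices mod p, and the image of a normal subgroup is stable under conjugation.
Conjugates of (0, λ; 0, 0) span every 2X with X of trace zero, which suffices for odd p. For p = 2
and M = 2m with m even, a commutator of T^m supplies what is missing. If p ∤ M, Bézout applied to
exponents of T together with N(1) = H₅ is enough.

When 4 ∤ m, the same Bézout argument, started from N(1) = H₅ or from H(2) = N(2), absorbs all powers
of 2 at once. -/

lemma lam_eq_goldenRatio : lam = Real.goldenRatio := by
  rw [lam, Real.cos_pi_div_five, Real.goldenRatio]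
  ring

lemma lam_pos : 0 < lam := lam_eq_goldenRatio ▸ Real.goldenRatio_pos

lemma lam_sq : lam ^ 2 = lam + 1 := lam_eq_goldenRatio ▸ Real.goldenRatio_sq

lemma lamZ_sq : lamZ ^ 2 = lamZ + 1 := Subtype.ext (by simpa [lamZ] using lam_sq)

lemma lamZ_mul_self : lamZ * lamZ = lamZ + 1 := by rw [← sq, lamZ_sq]

lemma exists_eq_add_mul_lamZ (x : ZLam) : ∃ a b : ℤ, x = a + b * lamZ := by
  suffices ∀ y ∈ Algebra.adjoin ℤ ({lam} : Set ℝ), ∃ a b : ℤ, y = a + b * lam by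
    obtain ⟨a, b, h⟩ := this x x.2
    exact ⟨a, b, Subtype.ext (by simpa [lamZ] using h)⟩
  intro y hy
  induction hy using Algebra.adjoin_induction with
  | mem y hy => exact ⟨0, 1, by simpa using hy⟩
  | algebraMap r => exact ⟨r, 0, by simp⟩
  | add x y _ _ hx hy =>
    obtain ⟨a, b, rfl⟩ := hx
    obtain ⟨c, d, rfl⟩ := hy
    exact ⟨a + c, b + d, by push_cast; ring⟩
  | mul x y _ _ hx hy =>
    obtain ⟨a, b, rfl⟩ := hx
    obtain ⟨c, d, rfl⟩ := hy
    exact ⟨a * c + b * d, a * d + b * c + b * d, by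
      push_cast; linear_combination (b * d : ℝ) * lam_sq⟩

lemma int_add_mul_lam_eq_zero {a b : ℤ} (h : (a : ℝ) + b * lam = 0) : a = 0 ∧ b = 0 := by
  have hb : b = 0 := by
    by_contra hb
    have := ((Real.goldenRatio_irrational.intCast_mul hb).intCast_add a).ne_zero
    exact this (lam_eq_goldenRatio ▸ h)
  subst hb
  simpa using h

lemma intCast_add_mul_lamZ_eq_zero {a b : ℤ} (h : (a : ZLam) + b * lamZ = 0) :
    a = 0 ∧ b = 0 :=
  int_add_mul_lam_eq_zero (by simpa [lamZ] using congrArg (Subtype.val) h)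

/-- Every nonzero element of `ℤ[λ]` divides its norm, a nonzero integer. -/
lemma exists_natCast_dvd {x : ZLam} (hx : x ≠ 0) : ∃ n : ℕ, n ≠ 0 ∧ x ∣ (n : ZLam) := by
  obtain ⟨a, b, rfl⟩ := exists_eq_add_mul_lamZ x
  -- The second factor is the Galois conjugate, since λ ↦ 1 - λ.
  have hnorm : (a + b * lamZ) * (((a + b : ℤ) : ZLam) + (-b : ℤ) * lamZ)
      = ((a ^ 2 + a * b - b ^ 2 : ℤ) : ZLam) := by
    push_cast
    linear_combination (-(b : ZLam) ^ 2) * lamZ_sq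
  have hne : a ^ 2 + a * b - b ^ 2 ≠ 0 := by
    intro h0
    rw [h0, Int.cast_zero] at hnorm
    obtain ⟨h1, h2⟩ := intCast_add_mul_lamZ_eq_zero ((mul_eq_zero.mp hnorm).resolve_left hx)
    exact hx (by simp [show b = 0 by omega, show a = 0 by omega])
  refine ⟨(a ^ 2 + a * b - b ^ 2).natAbs, Int.natAbs_ne_zero.mpr hne, ?_⟩
  have : (a + b * lamZ) ∣ ((a ^ 2 + a * b - b ^ 2 : ℤ) : ZLam) := ⟨_, hnorm.symm⟩
  rcases Int.natAbs_eq (a ^ 2 + a * b - b ^ 2) with h | h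
  · rwa [h, Int.cast_natCast] at this
  · rwa [h, Int.cast_neg, dvd_neg, Int.cast_natCast] at this

lemma not_two_dvd_one : ¬ (2 : ZLam) ∣ 1 := by
  rintro ⟨x, hx⟩
  obtain ⟨a, b, rfl⟩ := exists_eq_add_mul_lamZ x
  have := intCast_add_mul_lamZ_eq_zero (a := 2 * a - 1) (b := 2 * b) (by
    push_cast; linear_combination -hx)
  omega

lemma not_two_dvd_lamZ : ¬ (2 : ZLam) ∣ lamZ := fun h =>
  not_two_dvd_one ((h.mul_right (lamZ - 1)).trans
    (dvd_of_eq (by linear_combination lamZ_sq)))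

/-! ### The group `H₅` -/

/-- The element `S` of `H₅`. -/
def S : H5 := ⟨matS, Subgroup.subset_closure (by simp)⟩

/-- The underlying matrix of an element of `H₅`. -/
def toMat : H5 →* Matrix (Fin 2) (Fin 2) ZLam where
  toFun A := A.1.1
  map_one' := rfl
  map_mul' _ _ := rfl

lemma toMat_injective : Function.Injective toMat := fun _ _ h => Subtype.ext (Subtype.ext h)

lemma toMat_S : toMat S = !![0, 1; -1, 0] := rfl

lemma toMat_T : toMat T = !![1, lamZ; 0, 1] := rfl

lemma det_toMat (A : H5) :
    toMat A 0 0 * toMat A 1 1 - toMat A 0 1 * toMat A 1 0 = 1 := by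
  rw [← Matrix.det_fin_two]
  exact A.1.2

lemma toMat_inv (A : H5) :
    toMat A⁻¹ = !![toMat A 1 1, -toMat A 0 1; -toMat A 1 0, toMat A 0 0] := by
  rw [← Matrix.adjugate_fin_two]
  exact Matrix.SpecialLinearGroup.coe_inv A.1

lemma toMat_S_sq : toMat (S ^ 2) = -1 := by
  rw [map_pow, toMat_S, sq]
  ext i j
  fin_cases i <;> fin_cases j <;> simp

lemma S_pow_four : S ^ 4 = 1 := toMat_injective (by
  rw [show 4 = 2 * 2 from rfl, pow_mul, map_pow, toMat_S_sq, map_one]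
  simp)

lemma S_sq_mem_center (A : H5) : Commute (S ^ 2) A := toMat_injective (by
  simp [map_mul, toMat_S_sq])

lemma mem_Z_iff {A : H5} : A ∈ Z ↔ A = 1 ∨ A = S ^ 2 := by
  have h1 : ((A : SL2ZLam) = 1) ↔ A = 1 := by simp
  have h2 : ((A : SL2ZLam) = -1) ↔ A = S ^ 2 := by
    rw [← toMat_injective.eq_iff, toMat_S_sq]
    exact Subtype.ext_iff
  rw [← h1, ← h2]
  rfl

lemma toMat_TS : toMat (T * S) = !![-lamZ, 1; -1, 0] := by
  rw [map_mul, toMat_T, toMat_S]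
  ext i j
  fin_cases i <;> fin_cases j <;> simp

lemma toMat_TS_pow_two : toMat ((T * S) ^ 2) = !![lamZ, -lamZ; lamZ, -1] := by
  rw [pow_succ, pow_one, map_mul, toMat_TS]
  ext i j
  fin_cases i <;> fin_cases j <;> simp [Matrix.mul_apply, Fin.sum_univ_two, lamZ_mul_self]

lemma toMat_TS_pow_three : toMat ((T * S) ^ 3) = !![-1, lamZ; -lamZ, lamZ] := by
  rw [pow_succ, map_mul, toMat_TS_pow_two, toMat_TS]
  ext i j
  fin_cases i <;> fin_cases j <;> simp [Matrix.mul_apply, Fin.sum_univ_two, lamZ_mul_self]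

lemma toMat_TS_pow_four : toMat ((T * S) ^ 4) = !![0, -1; 1, -lamZ] := by
  rw [pow_succ, map_mul, toMat_TS_pow_three, toMat_TS]
  ext i j
  fin_cases i <;> fin_cases j <;> simp [Matrix.mul_apply, Fin.sum_univ_two, lamZ_mul_self]

lemma TS_pow_five : (T * S) ^ 5 = 1 := toMat_injective (by
  rw [pow_succ, map_mul, toMat_TS_pow_four, toMat_TS, map_one]
  ext i j
  fin_cases i <;> fin_cases j <;> simp [Matrix.mul_apply, Fin.sum_univ_two])

@[elab_as_elim]
-- Inverses are superfluous because S⁻¹ = S³ and T⁻¹ = S(TS)⁴.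
lemma H5_induction {p : H5 → Prop} (A : H5) (one : p 1) (S_mul : ∀ A, p A → p (S * A))
    (T_mul : ∀ A, p A → p (T * A)) : p A := by
  have S_inv : ∀ A, p A → p (S⁻¹ * A) := fun A hA => by
    rw [show S⁻¹ = S * S * S by rw [inv_eq_iff_mul_eq_one, ← S_pow_four]; simp only [pow_succ, pow_zero, one_mul, mul_assoc]]
    simpa only [mul_assoc] using S_mul _ (S_mul _ (S_mul _ hA))
  have TS_mul : ∀ A, p A → p (T * S * A) := fun A hA => by
    rw [mul_assoc]
    exact T_mul _ (S_mul _ hA)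
  have T_inv : ∀ A, p A → p (T⁻¹ * A) := fun A hA => by
    rw [show T⁻¹ = S * ((T * S) * (T * S) * (T * S) * (T * S)) by
      rw [inv_eq_iff_mul_eq_one, ← TS_pow_five]; simp only [pow_succ, pow_zero, one_mul, mul_assoc]]
    simpa only [mul_assoc] using
      S_mul _ (TS_mul _ (TS_mul _ (TS_mul _ (TS_mul _ hA))))
  obtain ⟨A, hA⟩ := A
  induction hA using Subgroup.closure_induction_left with
  | one => exact one
  | mul_left x hx y hy ih =>
    rcases hx with rfl | rfl
    · exact S_mul _ ih
    · exact T_mul _ ih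
  | inv_mul_cancel x hx y hy ih =>
    rcases hx with rfl | rfl
    · exact S_inv _ ih
    · exact T_inv _ ih

lemma toMat_T_pow (n : ℕ) : toMat (T ^ n) = !![1, n * lamZ; 0, 1] := by
  induction n with
  | zero => simp [Matrix.one_fin_two]
  | succ n ih =>
    rw [pow_succ, map_mul, ih, toMat_T]
    ext i j
    fin_cases i <;> fin_cases j <;> simp [Matrix.mul_apply, Fin.sum_univ_two]
    ring

/-! ### Principal congruence subgroups and normal closures of powers of `T` -/

lemma mem_H_iff {π : ZLam} {A : H5} : A ∈ H π ↔ ∃ X, toMat A = 1 + π • X := by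
  have h : A ∈ H π ↔ ∀ i j, π ∣ toMat A i j - (1 : Matrix (Fin 2) (Fin 2) ZLam) i j := by
    simp only [H, Subgroup.mem_comap, MonoidHom.mem_ker, Matrix.SpecialLinearGroup.ext_iff,
      ← Ideal.mem_span_singleton, ← Ideal.Quotient.eq]
    refine forall₂_congr fun i j => ?_
    rw [show Ideal.Quotient.mk (Ideal.span {π}) ((1 : Matrix (Fin 2) (Fin 2) ZLam) i j)
      = (1 : Matrix (Fin 2) (Fin 2) (ZLam ⧸ Ideal.span {π})) i j by
        rw [Matrix.one_apply, Matrix.one_apply]; split_ifs <;> simp]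
    rfl
  rw [h]
  constructor
  · intro h
    choose X hX using h
    refine ⟨Matrix.of X, ?_⟩
    ext i j
    simp only [Matrix.add_apply, Matrix.smul_apply, Matrix.of_apply, smul_eq_mul, ← hX]
    push_cast
    ring
  · rintro ⟨X, hX⟩ i j
    exact ⟨X i j, by simp [hX]⟩

instance (π : ZLam) : (H π).Normal := by
  unfold H
  infer_instance

lemma H_le_H_of_dvd {π ρ : ZLam} (h : π ∣ ρ) : H ρ ≤ H π := by
  obtain ⟨σ, rfl⟩ := h
  intro A hA
  obtain ⟨X, hX⟩ := mem_H_iff.mp hA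
  exact mem_H_iff.mpr ⟨σ • X, by rw [hX, smul_smul]⟩

lemma dvd_of_mem_H {π : ZLam} {A : H5} (hA : A ∈ H π) {i j : Fin 2} (hij : i ≠ j) :
    π ∣ toMat A i j := by
  obtain ⟨X, hX⟩ := mem_H_iff.mp hA
  exact ⟨X i j, by simp [hX, Matrix.one_apply_ne hij]⟩

lemma mem_H_mul_of_coprime {a b : ℕ} (h : a.Coprime b) {A : H5} (ha : A ∈ H a) (hb : A ∈ H b) :
    A ∈ H (a * b : ℕ) := by
  obtain ⟨X, hX⟩ := mem_H_iff.mp ha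
  obtain ⟨Y, hY⟩ := mem_H_iff.mp hb
  have hXY : (a : ZLam) • X = (b : ZLam) • Y := add_left_cancel (hX.symm.trans hY)
  obtain ⟨u, v, huv⟩ : IsCoprime (a : ZLam) (b : ZLam) := Nat.Coprime.cast h
  refine mem_H_iff.mpr ⟨u • Y + v • X, ?_⟩
  rw [hX]
  congr 1
  calc (a : ZLam) • X = (u * a + v * b) • (a : ZLam) • X := by rw [huv, one_smul]
    _ = (u * a) • (b : ZLam) • Y + (v * b) • (a : ZLam) • X := by rw [add_smul, ← hXY]
    _ = _ := by push_cast; module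

/-- The normal closure of `T ^ m` in `H₅`. -/
def N (m : ℕ) : Subgroup H5 := Subgroup.normalClosure {T ^ m}

instance (m : ℕ) : (N m).Normal := by
  unfold N
  infer_instance

lemma T_pow_mem_N (m : ℕ) : T ^ m ∈ N m := Subgroup.subset_normalClosure rfl

lemma N_le {m : ℕ} {K : Subgroup H5} [K.Normal] (h : T ^ m ∈ K) : N m ≤ K :=
  Subgroup.normalClosure_le_normal (by simpa using h)

lemma T_pow_eq (m : ℕ) : toMat (T ^ m) = 1 + (m : ZLam) • !![0, lamZ; 0, 0] := by
  rw [toMat_T_pow]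
  ext i j
  fin_cases i <;> fin_cases j <;> simp

lemma N_le_H (m : ℕ) : N m ≤ H m := N_le (mem_H_iff.mpr ⟨_, T_pow_eq m⟩)

lemma N_le_N_of_dvd {m n : ℕ} (h : m ∣ n) : N n ≤ N m := by
  obtain ⟨k, rfl⟩ := h
  exact N_le (pow_mul T m k ▸ pow_mem (T_pow_mem_N m) k)

lemma N_le_sup {d m q : ℕ} (h : m.Coprime q) : N d ≤ N (d * m) ⊔ H q := by
  refine N_le ?_
  obtain ⟨u, v, huv⟩ : IsCoprime (m : ℤ) (q : ℤ) := Nat.isCoprime_iff_coprime.mpr h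
  have : T ^ d = (T ^ (d * m)) ^ u * (T ^ q) ^ (d * v) := by
    simp only [← zpow_natCast, ← _root_.zpow_mul, ← _root_.zpow_add]
    congr 1
    push_cast
    linear_combination -(d : ℤ) * huv
  rw [this]
  exact mul_mem
    (Subgroup.mem_sup_left (zpow_mem (T_pow_mem_N _) _))
    (Subgroup.mem_sup_right (zpow_mem (N_le_H _ (T_pow_mem_N _)) _))

/-- By `N_le_sup`, A = BC with B ∈ N(dm) and C ∈ H(q). Both A and B are trivial mod m, hence so is
C, and coprimality puts C in H(mq). No coprimality of d and q is needed, so d = 2 can be used with q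
a power of 2. -/
lemma H_le_sup_of_coprime {d m q : ℕ} (h : m.Coprime q) (hH : H d ≤ N d) :
    H (d * m : ℕ) ≤ N (d * m) ⊔ H (m * q : ℕ) := by
  intro A hA
  have hAd : A ∈ H d := H_le_H_of_dvd (by push_cast; exact dvd_mul_right _ _) hA
  have hle : H (d * m : ℕ) ≤ H m := H_le_H_of_dvd (by push_cast; exact dvd_mul_left _ _)
  obtain ⟨B, hB, C, hC, rfl⟩ := Subgroup.mem_sup_of_normal_left.mp (N_le_sup h (hH hAd))
  refine mul_mem (Subgroup.mem_sup_left hB) (Subgroup.mem_sup_right ?_)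
  refine mem_H_mul_of_coprime h ?_ hC
  have := mul_mem (inv_mem (hle (N_le_H _ hB))) (hle hA)
  rwa [inv_mul_cancel_left] at this

/-! ### Base cases: N(1) = H₅ and H(2) = N(2) -/

lemma N_one : N 1 = ⊤ := by
  have hT : T ∈ N 1 := by simpa using T_pow_mem_N 1
  have hq : (QuotientGroup.mk' (N 1)) T = 1 := (QuotientGroup.eq_one_iff _).mpr hT
  have h4 := congrArg (QuotientGroup.mk' (N 1)) S_pow_four
  have h5 := congrArg (QuotientGroup.mk' (N 1)) TS_pow_five
  rw [map_pow, map_mul, hq, one_mul, map_one, pow_succ] at h5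
  rw [map_pow, map_one] at h4
  rw [h4, one_mul] at h5
  have hS : S ∈ N 1 := (QuotientGroup.eq_one_iff _).mp h5
  refine (Subgroup.eq_top_iff' _).mpr fun A => ?_
  induction A using H5_induction with
  | one => exact one_mem _
  | S_mul A hA => exact mul_mem hS hA
  | T_mul A hA => exact mul_mem hT hA

/-- The relations give (ts)⁻¹ = s² · t(ts)t⁻¹ with s² commuting with everything in sight. Fifth
powers yield 1 = s¹⁰ = s². For Q = H₅/N(2) this makes the quotient dihedral. -/
lemma dihedral_relations {Q : Type*} [Group Q] {s t : Q} (ht : t ^ 2 = 1) (hs : s ^ 4 = 1)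
    (hst : Commute (s ^ 2) t) (h : (t * s) ^ 5 = 1) : s ^ 2 = 1 := by
  have hti : t⁻¹ = t := by rw [inv_eq_iff_mul_eq_one, ← sq, ht]
  have h1 : (t * s)⁻¹ = s ^ 2 * (t * (t * s) * t⁻¹) := by
    have hsi : s⁻¹ = s ^ 3 := by rw [inv_eq_iff_mul_eq_one, ← pow_succ', hs]
    rw [_root_.mul_inv_rev, hti, ← mul_assoc t, ← sq, ht, one_mul, ← mul_assoc, hsi, pow_succ]
  have hc : Commute (s ^ 2) (t * (t * s) * t⁻¹) := by
    have : Commute (s ^ 2) s := (Commute.refl s).pow_left 2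
    exact ((hst.mul_right (hst.mul_right this)).mul_right hst.inv_right)
  have h5 := congrArg (· ^ 5) h1
  simp only [inv_pow, h, hc.mul_pow, conj_pow] at h5
  have : s ^ 2 = (s ^ 2) ^ 5 * (s ^ 4)⁻¹ ^ 2 := by group
  rw [this, hs]
  simpa using h5.symm

lemma exists_pow_eq_of_N_two (A : H5) :
    ∃ i : ℕ, (A : H5 ⧸ N 2) = ((T * S) ^ i : H5) ∨ (A : H5 ⧸ N 2) = (S * (T * S) ^ i : H5) := by
  set q := QuotientGroup.mk' (N 2)
  have ht : q T ^ 2 = 1 := by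
    rw [← map_pow]
    exact (QuotientGroup.eq_one_iff _).mpr (T_pow_mem_N 2)
  have h5 : (q T * q S) ^ 5 = 1 := by rw [← map_mul, ← map_pow, TS_pow_five, map_one]
  have hs : q S ^ 2 = 1 := by
    refine dihedral_relations ht ?_ ?_ h5
    · rw [← map_pow, S_pow_four, map_one]
    · simpa using (S_sq_mem_center T).map q
  change ∃ i : ℕ, q A = q ((T * S) ^ i) ∨ q A = q (S * (T * S) ^ i)
  simp only [map_mul, map_pow]
  rw [sq] at hs ht
  induction A using H5_induction with
  | one => exact ⟨0, by simp⟩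
  | S_mul A hA =>
    obtain ⟨i, hi | hi⟩ := hA
    · exact ⟨i, Or.inr (by rw [map_mul, hi])⟩
    · exact ⟨i, Or.inl (by rw [map_mul, hi, ← mul_assoc, hs, one_mul])⟩
  | T_mul A hA =>
    obtain ⟨i, hi | hi⟩ := hA
    · refine ⟨4 + i, Or.inr ?_⟩
      have h4 : (q T * q S) ^ 4 = q S * q T := by
        rw [pow_succ, mul_eq_one_iff_eq_inv, _root_.mul_inv_rev, inv_eq_of_mul_eq_one_left hs,
          inv_eq_of_mul_eq_one_left ht] at h5
        exact h5
      rw [map_mul, hi, pow_add, h4, ← mul_assoc, ← mul_assoc, hs, one_mul]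
    · exact ⟨i + 1, Or.inl (by rw [map_mul, hi, pow_succ', mul_assoc])⟩

/-- Each coset of N(2) is represented by (TS)^i or S(TS)^i with i < 5. Except for the identity, each
representative has an off-diagonal entry ±1 or ±λ, a unit, so it is not trivial mod 2. -/
lemma H_two_le_N_two : H 2 ≤ N 2 := by
  intro A hA
  have key : ∀ B : H5, (A : H5 ⧸ N 2) = B → B ∈ H 2 := by
    intro B hAB
    have := mul_mem hA (N_le_H 2 (QuotientGroup.eq.mp hAB))
    rwa [mul_inv_cancel_left] at this
  have hmod : ∀ i, (T * S) ^ i = (T * S) ^ (i % 5) := fun i => pow_eq_pow_mod i TS_pow_five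
  have hu1 : ∀ {x : ZLam}, 2 ∣ x → x = 1 ∨ x = -1 ∨ x = lamZ ∨ x = -lamZ → False := by
    rintro x hx (rfl | rfl | rfl | rfl)
    · exact not_two_dvd_one hx
    · exact not_two_dvd_one ((dvd_neg).mp hx)
    · exact not_two_dvd_lamZ hx
    · exact not_two_dvd_lamZ ((dvd_neg).mp hx)
  have hSmul : ∀ B, toMat (S * B) 0 1 = toMat B 1 1 ∧ toMat (S * B) 1 0 = -toMat B 0 0 := by
    intro B
    simp [map_mul, toMat_S, Matrix.mul_apply, Fin.sum_univ_two]
  obtain ⟨i, hi | hi⟩ := exists_pow_eq_of_N_two A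
  · rw [hmod] at hi
    have hB := dvd_of_mem_H (key _ hi) (i := 1) (j := 0) (by decide)
    have hlt := Nat.mod_lt i (show 5 > 0 by norm_num)
    interval_cases i % 5
    · exact (QuotientGroup.eq_one_iff A).mp hi
    · rw [pow_one, toMat_TS] at hB
      exact (hu1 hB (by simp)).elim
    · rw [toMat_TS_pow_two] at hB
      exact (hu1 hB (by simp)).elim
    · rw [toMat_TS_pow_three] at hB
      exact (hu1 hB (by simp)).elim
    · rw [toMat_TS_pow_four] at hB
      exact (hu1 hB (by simp)).elim
  · exfalso
    rw [hmod] at hi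
    have hB := dvd_of_mem_H (key _ hi) (i := 0) (j := 1) (by decide)
    have hC := dvd_of_mem_H (key _ hi) (i := 1) (j := 0) (by decide)
    rw [(hSmul _).1] at hB
    rw [(hSmul _).2] at hC
    have hlt := Nat.mod_lt i (show 5 > 0 by norm_num)
    interval_cases i % 5
    · exact hu1 hB (by simp)
    · rw [pow_one, toMat_TS] at hC
      exact hu1 hC (by simp)
    · rw [toMat_TS_pow_two] at hB
      exact hu1 hB (by simp)
    · rw [toMat_TS_pow_three] at hB
      exact hu1 hB (by simp)
    · rw [toMat_TS_pow_four] at hB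
      exact hu1 hB (by simp)

/-! ### The additive group of first order terms -/

/-- For a normal subgroup `K` of `H₅`, the matrices `X` such that `K` contains an element congruent
to `1 + M X` modulo `p M`, where `M = p k`. -/
def firstOrder (K : Subgroup H5) (p k : ZLam) :
    AddSubgroup (Matrix (Fin 2) (Fin 2) ZLam) where
  carrier := {X | ∃ B ∈ K, ∃ Y, toMat B = 1 + (p * k) • (X + p • Y)}
  zero_mem' := ⟨1, one_mem _, 0, by simp⟩
  add_mem' := by
    rintro X₁ X₂ ⟨B₁, hB₁, Y₁, h₁⟩ ⟨B₂, hB₂, Y₂, h₂⟩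
    -- The cross term carries (pk)², which is divisible by p · (pk); this is why p must divide the
    -- modulus.
    refine ⟨B₁ * B₂, mul_mem hB₁ hB₂, Y₁ + Y₂ + k • ((X₁ + p • Y₁) * (X₂ + p • Y₂)), ?_⟩
    rw [map_mul, h₁, h₂]
    simp only [add_mul, mul_add, one_mul, mul_one, smul_mul_assoc, mul_smul_comm]
    module
  neg_mem' := by
    rintro X ⟨B, hB, Y, h⟩
    refine ⟨B⁻¹, inv_mem hB,
      -Y + k • ((X + p • Y) * ((X + p • Y) * toMat B⁻¹)), ?_⟩
    have h1 : toMat B * toMat B⁻¹ = 1 := by rw [← map_mul, mul_inv_cancel, map_one]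
    rw [h, add_mul, one_mul, smul_mul_assoc] at h1
    set D := toMat B⁻¹
    set W := X + p • Y
    have h2 : W * D + (p * k) • (W * (W * D)) = W := by
      simpa only [mul_add, mul_smul_comm, mul_one] using congrArg (W * ·) h1
    calc D = 1 - (p * k) • (W * D) := eq_sub_of_add_eq h1
      _ = 1 - (p * k) • (W - (p * k) • (W * (W * D))) := by rw [← eq_sub_of_add_eq h2]
      _ = 1 + (p * k) • (-X + p • (-Y + k • (W * (W * D)))) := by
        simp only [W]
        module

variable {K : Subgroup H5} {p k : ZLam}

lemma smul_mem_firstOrder (Y : Matrix (Fin 2) (Fin 2) ZLam) : p • Y ∈ firstOrder K p k :=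
  ⟨1, one_mem _, -Y, by rw [map_one]; module⟩

lemma conj_mem_firstOrder [hK : K.Normal] {X : Matrix (Fin 2) (Fin 2) ZLam}
    (hX : X ∈ firstOrder K p k) (A : H5) :
    toMat A * X * toMat A⁻¹ ∈ firstOrder K p k := by
  obtain ⟨B, hB, Y, h⟩ := hX
  refine ⟨A * B * A⁻¹, hK.conj_mem B hB A, toMat A * Y * toMat A⁻¹, ?_⟩
  have h1 : toMat A * toMat A⁻¹ = 1 := by rw [← map_mul, mul_inv_cancel, map_one]
  rw [map_mul, map_mul, h]
  simp only [mul_add, add_mul, mul_one, h1, mul_smul_comm, smul_mul_assoc]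

/-- An element B of K with the same first-order term as A differs from A by an element of H(p · pk).
-/
lemma mem_sup_of_mem_firstOrder [K.Normal] {X : Matrix (Fin 2) (Fin 2) ZLam}
    (hX : X ∈ firstOrder K p k) {A : H5} (hA : toMat A = 1 + (p * k) • X) :
    A ∈ K ⊔ H (p * (p * k)) := by
  obtain ⟨B, hB, Y, h⟩ := hX
  refine Subgroup.mem_sup_of_normal_left.mpr
    ⟨B, hB, B⁻¹ * A, mem_H_iff.mpr ⟨-(toMat B⁻¹ * Y), ?_⟩, by simp⟩
  have h1 : toMat B⁻¹ * toMat B = 1 := by rw [← map_mul, inv_mul_cancel, map_one]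
  have h2 : toMat A = toMat B - (p * (p * k)) • Y := by
    rw [hA, h]
    module
  rw [map_mul, h2, mul_sub, h1, mul_smul_comm]
  module

/-- The matrix `(a, b; c, -a)`. -/
def tr0 (a b c : ZLam) : Matrix (Fin 2) (Fin 2) ZLam := !![a, b; c, -a]

lemma tr0_add (a b c a' b' c' : ZLam) :
    tr0 a b c + tr0 a' b' c' = tr0 (a + a') (b + b') (c + c') := by
  ext i j
  fin_cases i <;> fin_cases j <;> simp [tr0, add_comm]

lemma tr0_smul (t a b c : ZLam) : t • tr0 a b c = tr0 (t * a) (t * b) (t * c) := by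
  ext i j
  fin_cases i <;> fin_cases j <;> simp [tr0]

lemma conj_S_tr0 (a b c : ZLam) : toMat S * tr0 a b c * toMat S⁻¹ = tr0 (-a) (-c) (-b) := by
  rw [toMat_inv, toMat_S]
  ext i j
  fin_cases i <;> fin_cases j <;> simp [tr0, Matrix.mul_apply, Fin.sum_univ_two]

lemma conj_T_tr0 (a b c : ZLam) : toMat T * tr0 a b c * toMat T⁻¹ =
    tr0 (a + lamZ * c) (b - 2 * lamZ * a - (lamZ + 1) * c) c := by
  rw [toMat_inv, toMat_T]
  refine Matrix.ext fun i j => ?_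
  fin_cases i <;> fin_cases j <;> simp [tr0, Matrix.mul_apply, Fin.sum_univ_two]
  · linear_combination (-c) * lamZ_sq
  · ring

lemma tr0_mem_of_basis {L : AddSubgroup (Matrix (Fin 2) (Fin 2) ZLam)} {t : ZLam}
    (h1 : tr0 t 0 0 ∈ L) (h2 : tr0 (t * lamZ) 0 0 ∈ L) (h3 : tr0 0 t 0 ∈ L)
    (h4 : tr0 0 (t * lamZ) 0 ∈ L) (h5 : tr0 0 0 t ∈ L) (h6 : tr0 0 0 (t * lamZ) ∈ L)
    (a b c : ZLam) : tr0 (t * a) (t * b) (t * c) ∈ L := by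
  obtain ⟨a₁, a₂, rfl⟩ := exists_eq_add_mul_lamZ a
  obtain ⟨b₁, b₂, rfl⟩ := exists_eq_add_mul_lamZ b
  obtain ⟨c₁, c₂, rfl⟩ := exists_eq_add_mul_lamZ c
  have := add_mem (add_mem
    (add_mem (zsmul_mem h1 a₁) (zsmul_mem h2 a₂)) (add_mem (zsmul_mem h3 b₁) (zsmul_mem h4 b₂)))
    (add_mem (zsmul_mem h5 c₁) (zsmul_mem h6 c₂))
  convert this using 1
  simp only [← Int.cast_smul_eq_zsmul ZLam, tr0_smul, tr0_add]
  congr 1 <;> ring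

lemma tr0_neg (a b c : ZLam) : -tr0 a b c = tr0 (-a) (-b) (-c) := by
  rw [← neg_one_smul ZLam, tr0_smul, neg_one_mul, neg_one_mul, neg_one_mul]

lemma tr0_comb_mem {L : AddSubgroup (Matrix (Fin 2) (Fin 2) ZLam)} (x y z : ℤ) {a b c a' b' c' a'' b'' c'' : ZLam} (h : tr0 a b c ∈ L)
    (h' : tr0 a' b' c' ∈ L) (h'' : tr0 a'' b'' c'' ∈ L) :
    tr0 (x * a + y * a' + z * a'') (x * b + y * b' + z * b'') (x * c + y * c' + z * c'') ∈ L := by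
  have := add_mem (add_mem (zsmul_mem h x) (zsmul_mem h' y)) (zsmul_mem h'' z)
  simpa only [← Int.cast_smul_eq_zsmul ZLam, tr0_smul, tr0_add] using this

/-- A lattice is a Hecke lattice if it is invariant under conjugation by `H₅` and contains
`(0, λ; 0, 0)`. -/
structure IsHeckeLattice (L : AddSubgroup (Matrix (Fin 2) (Fin 2) ZLam)) : Prop where
  conj (A : H5) {X : Matrix (Fin 2) (Fin 2) ZLam} : X ∈ L → toMat A * X * toMat A⁻¹ ∈ L
  upper_mem : tr0 0 lamZ 0 ∈ L

namespace IsHeckeLattice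

variable {L : AddSubgroup (Matrix (Fin 2) (Fin 2) ZLam)}

lemma conj_S (hL : IsHeckeLattice L) {a b c : ZLam} (h : tr0 a b c ∈ L) :
    tr0 a c b ∈ L := by
  have := neg_mem (hL.conj S h)
  rw [conj_S_tr0, tr0_neg] at this
  simpa using this

lemma conj_T (hL : IsHeckeLattice L) {a b c : ZLam} (h : tr0 a b c ∈ L) :
    tr0 (a + lamZ * c) (b - 2 * lamZ * a - (lamZ + 1) * c) c ∈ L := by
  rw [← conj_T_tr0]
  exact hL.conj T h

end IsHeckeLattice
namespace IsHeckeLattice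

variable {L : AddSubgroup (Matrix (Fin 2) (Fin 2) ZLam)}

lemma diag_sub_upper_mem (hL : IsHeckeLattice L) : tr0 (lamZ + 1) (-1) 0 ∈ L := by
  have h := tr0_comb_mem 1 (-1) 2 (hL.conj_T (hL.conj_S hL.upper_mem)) (hL.conj_S hL.upper_mem)
    hL.upper_mem
  convert h using 2
  · push_cast; linear_combination -lamZ_sq
  · push_cast; linear_combination lamZ_sq
  · push_cast; ring

/-- Conjugating a diagonal matrix by T changes it by an upper entry with a factor 2; this is the
source of the special role of the prime 2. -/
lemma two_upper_mem (hL : IsHeckeLattice L) : tr0 0 2 0 ∈ L := by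
  have h := tr0_comb_mem (-1) 1 (-4) (hL.conj_T hL.diag_sub_upper_mem) hL.diag_sub_upper_mem
    hL.upper_mem
  convert h using 2
  · push_cast; ring
  · push_cast; linear_combination (-2) * lamZ_sq
  · push_cast; ring

lemma two_diag_mem (hL : IsHeckeLattice L) : tr0 2 0 0 ∈ L ∧ tr0 (2 * lamZ) 0 0 ∈ L := by
  have h2 : tr0 (2 * lamZ) 0 0 ∈ L := by
    have h := tr0_comb_mem 1 (-1) 1 (hL.conj_T (hL.conj_S hL.two_upper_mem))
      (hL.conj_S hL.two_upper_mem) hL.two_upper_mem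
    have h := tr0_comb_mem 1 2 0 h hL.upper_mem hL.upper_mem
    convert h using 2 <;> push_cast <;> ring
  refine ⟨?_, h2⟩
  have h := tr0_comb_mem 2 1 (-1) hL.diag_sub_upper_mem hL.two_upper_mem h2
  convert h using 2 <;> push_cast <;> ring

lemma two_mul_mem (hL : IsHeckeLattice L) (a b c : ZLam) :
    tr0 (2 * a) (2 * b) (2 * c) ∈ L := by
  have h : tr0 0 (2 * lamZ) 0 ∈ L := by
    convert tr0_comb_mem 2 0 0 hL.upper_mem hL.upper_mem hL.upper_mem using 2 <;> push_cast <;> ring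
  exact tr0_mem_of_basis hL.two_diag_mem.1 hL.two_diag_mem.2 hL.two_upper_mem h
    (hL.conj_S hL.two_upper_mem) (hL.conj_S h) a b c

/-- Subtracting `diag_sub_upper_mem` isolates (0, 1; 0, 0), whose conjugates then give a full basis
without the factor 2. -/
lemma mem_of_diag_mem (hL : IsHeckeLattice L) (h : tr0 (lamZ + 1) 0 0 ∈ L) (a b c : ZLam) :
    tr0 a b c ∈ L := by
  have h1 : tr0 0 1 0 ∈ L := by
    convert tr0_comb_mem 1 (-1) 0 h hL.diag_sub_upper_mem h using 2 <;> push_cast <;> ring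
  have h2 : tr0 lamZ 0 0 ∈ L := by
    have := tr0_comb_mem 1 (-1) 1 (hL.conj_T (hL.conj_S h1)) (hL.conj_S h1) h1
    convert tr0_comb_mem 1 1 0 this hL.upper_mem h using 2 <;> push_cast <;> ring
  have h3 : tr0 1 0 0 ∈ L := by
    convert tr0_comb_mem 1 (-1) 0 h h2 h using 2 <;> push_cast <;> ring
  have := tr0_mem_of_basis (t := 1) h3 (by simpa using h2) h1 (by simpa using hL.upper_mem)
    (hL.conj_S h1) (by simpa using hL.conj_S hL.upper_mem) a b c
  simpa using this

end IsHeckeLattice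

/-! ### Generating H(M) modulo H(pM) -/

lemma isHeckeLattice_firstOrder {K : Subgroup H5} [K.Normal] {p k : ZLam} {A : H5} (hA : A ∈ K)
    (h : toMat A = 1 + (p * k) • !![0, lamZ; 0, 0]) : IsHeckeLattice (firstOrder K p k) where
  conj A _ hX := conj_mem_firstOrder hX A
  upper_mem := ⟨A, hA, 0, by simp [h, tr0]⟩

/-- With M = pk, det(1 + MX) = 1 forces tr X = -M det X, so X has trace zero mod p. -/
lemma eq_tr0_add_smul {p k : ZLam} (hpk : p * k ≠ 0) {A : H5} {X : Matrix (Fin 2) (Fin 2) ZLam}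
    (h : toMat A = 1 + (p * k) • X) : ∃ Y, X = tr0 (X 0 0) (X 0 1) (X 1 0) + p • Y := by
  have hdet := det_toMat A
  have htr : X 0 0 + X 1 1 = p * (-k * (X 0 0 * X 1 1 - X 0 1 * X 1 0)) := by
    apply mul_left_cancel₀ hpk
    simp [h] at hdet
    linear_combination hdet
  refine ⟨!![0, 0; 0, -k * (X 0 0 * X 1 1 - X 0 1 * X 1 0)], ?_⟩
  refine Matrix.ext fun i j => ?_
  fin_cases i <;> fin_cases j <;> simp [tr0] 
  linear_combination htr

/-- For an odd `p` dividing `m`, the group `H(m) / H(p m)` is generated by conjugates of `T ^ m`. -/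
lemma H_le_sup_of_odd_dvd {p m : ℕ} (hp : Odd p) (hm : m ≠ 0) (hpm : p ∣ m) :
    H m ≤ N m ⊔ H (p * m : ℕ) := by
  obtain ⟨k, rfl⟩ := hpm
  obtain ⟨l, hl⟩ := hp
  have hl' : (p : ZLam) = 2 * l + 1 := by rw [hl]; push_cast; rfl
  intro A hA
  obtain ⟨X, hX⟩ := mem_H_iff.mp hA
  have hL : IsHeckeLattice (firstOrder (N (p * k)) (p : ZLam) k) :=
    isHeckeLattice_firstOrder (T_pow_mem_N _) (by rw [T_pow_eq]; push_cast; rfl)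
  push_cast at hX ⊢
  have hpk : (p : ZLam) * k ≠ 0 := by exact_mod_cast hm
  refine mem_sup_of_mem_firstOrder ?_ hX
  obtain ⟨Y, hY⟩ := eq_tr0_add_smul hpk hX
  rw [hY]
  refine add_mem ?_ (smul_mem_firstOrder _)
  -- With p = 2l + 1, write X = pX - l(2X).
  convert sub_mem (smul_mem_firstOrder (tr0 (X 0 0) (X 0 1) (X 1 0)))
    (nsmul_mem (hL.two_mul_mem (X 0 0) (X 0 1) (X 1 0)) l) using 1
  rw [← tr0_smul, hl', ← Nat.cast_smul_eq_nsmul ZLam]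
  module

/-- For even `m`, the group `H(2 m) / H(4 m)` is generated by the conjugates of `T ^ (2 m)` and of
a commutator of `T ^ m`. -/
lemma H_two_mul_le_sup {m : ℕ} (hm : m ≠ 0) (h2 : 2 ∣ m) :
    H (2 * m : ℕ) ≤ N m ⊔ H (4 * m : ℕ) := by
  obtain ⟨k, rfl⟩ := h2
  intro A hA
  obtain ⟨X, hX⟩ := mem_H_iff.mp hA
  have hL : IsHeckeLattice (firstOrder (N (2 * k)) (2 : ZLam) (2 * k)) :=
    isHeckeLattice_firstOrder (N_le_N_of_dvd (dvd_mul_left _ 2) (T_pow_mem_N _))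
      (by rw [T_pow_eq]; push_cast; rfl)
  push_cast at hX ⊢
  have hpk : (2 : ZLam) * (2 * k) ≠ 0 := by
    have : (k : ZLam) ≠ 0 := by
      rintro h
      exact hm (by rw [Nat.cast_eq_zero.mp h])
    simpa using this
  have hdiag : tr0 (lamZ + 1) 0 0 ∈ firstOrder (N (2 * k)) (2 : ZLam) (2 * k) := by
    -- To first order, the commutator of 1 + mλE and 1 - 2λF (m = 2k; E, F the elementary
    -- nilpotents) is 1 - 2mλ² diag(1, -1), and λ² = λ + 1. The terms in 4m and 2m² vanish mod 4m
    -- because m is even.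
    set P := T ^ (2 * k)
    set Q := S * T ^ 2 * S⁻¹
    rw [← neg_mem_iff]
    refine ⟨P * (Q * P⁻¹ * Q⁻¹), mul_mem (T_pow_mem_N _)
      (Subgroup.Normal.conj_mem inferInstance _ (inv_mem (T_pow_mem_N _)) _),
      !![2 * k * lamZ ^ 4, k * lamZ ^ 3; lamZ ^ 3, 0], ?_⟩
    have hP : toMat P = !![1, (2 * k) * lamZ; 0, 1] := by
      rw [toMat_T_pow]
      push_cast
      rfl
    have hQ : toMat Q = !![1, 0; -(2 * lamZ), 1] := by
      rw [map_mul, map_mul, toMat_inv, toMat_T_pow, toMat_S]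
      refine Matrix.ext fun i j => ?_
      fin_cases i <;> fin_cases j <;> simp [Matrix.mul_apply, Fin.sum_univ_two]
    rw [map_mul, map_mul, map_mul, toMat_inv, toMat_inv, hP, hQ, tr0_neg]
    refine Matrix.ext fun i j => ?_
    fin_cases i <;> fin_cases j <;> simp [Matrix.mul_apply, Fin.sum_univ_two, tr0]
    · linear_combination (-4 * (k : ZLam)) * lamZ_sq
    · ring
    · ring
    · linear_combination (4 * (k : ZLam)) * lamZ_sq
  rw [show (4 : ZLam) * (2 * k) = 2 * (2 * (2 * k)) by ring]
  refine mem_sup_of_mem_firstOrder ?_ hX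
  obtain ⟨Y, hY⟩ := eq_tr0_add_smul hpk hX
  rw [hY]
  exact add_mem (hL.mem_of_diag_mem hdiag _ _ _) (smul_mem_firstOrder _)

/-! ### Descent to arbitrary multiples -/

lemma H_le_sup_prime {p m : ℕ} (hp : p.Prime) (hodd : p ≠ 2) (hm : m ≠ 0) :
    H m ≤ N m ⊔ H (p * m : ℕ) := by
  by_cases h : p ∣ m
  · exact H_le_sup_of_odd_dvd (hp.odd_of_ne_two hodd) hm h
  · have := H_le_sup_of_coprime (d := 1) (m := m) ((hp.coprime_iff_not_dvd.mpr h).symm)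
      (N_one ▸ le_top)
    rwa [one_mul, mul_comm m p] at this

lemma sup_step {m M M' n : ℕ} {π : ZLam} (hm : m ∣ M') (h : H π ≤ N m ⊔ H M)
    (hM : H M ≤ N M' ⊔ H n) : H π ≤ N m ⊔ H n :=
  h.trans (sup_le le_sup_left (hM.trans (sup_le_sup_right (N_le_N_of_dvd hm) _)))

lemma H_le_sup_mul_odd {m n : ℕ} (hm : m ≠ 0) (hn : Odd n) : H m ≤ N m ⊔ H (n * m : ℕ) := by
  induction n using induction_on_primes with
  | zero => simp at hn
  | one => simp
  | prime_mul p a hp ih =>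
    obtain ⟨h1, h2⟩ := Nat.odd_mul.mp hn
    rw [mul_assoc]
    exact sup_step (dvd_mul_left m a) (ih h2) (H_le_sup_prime hp
      (by rintro rfl; exact absurd h1 (by decide)) (mul_ne_zero h2.pos.ne' hm))

/-- For even `m`, every principal congruence subgroup generates together with `N(m)` a group that
contains `H(2 m)`. -/
lemma H_two_mul_le_sup_mul {m n : ℕ} (hm : m ≠ 0) (h2 : 2 ∣ m) (hn : n ≠ 0) :
    H (2 * m : ℕ) ≤ N m ⊔ H (n * (2 * m) : ℕ) := by
  induction n using induction_on_primes with
  | zero => exact absurd rfl hn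
  | one => simp
  | prime_mul p a hp ih =>
    have ha : a ≠ 0 := right_ne_zero_of_mul hn
    specialize ih ha
    by_cases hp2 : p = 2
    · subst hp2
      refine sup_step (M' := a * m) (dvd_mul_left m a) ih ?_
      have := H_two_mul_le_sup (mul_ne_zero ha hm) (h2.mul_left a)
      rwa [show 2 * (a * m) = a * (2 * m) by ring,
        show 4 * (a * m) = 2 * a * (2 * m) by ring] at this
    · rw [mul_assoc]
      exact sup_step (((dvd_mul_left m 2)).mul_left a) ih
        (H_le_sup_prime hp hp2 (mul_ne_zero ha (mul_ne_zero two_ne_zero hm)))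

/-- If `4` does not divide `m`, every principal congruence subgroup generates together with `N(m)`
a group that contains `H(m)`. -/
lemma H_le_sup_mul {m n : ℕ} (h4 : ¬ 4 ∣ m) (hn : n ≠ 0) : H m ≤ N m ⊔ H (n * m : ℕ) := by
  obtain ⟨k, n, hodd, rfl⟩ := Nat.exists_eq_two_pow_mul_odd hn
  obtain ⟨d, m, hd, hd2, hm, rfl⟩ : ∃ d m' : ℕ, H d ≤ N d ∧ d ∣ 2 ∧ Odd m' ∧ m = d * m' := by
    rcases Nat.even_or_odd m with he | ho
    · obtain ⟨l, rfl⟩ := he.two_dvd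
      refine ⟨2, l, by exact_mod_cast H_two_le_N_two, dvd_rfl, ?_, rfl⟩
      rw [← Nat.not_even_iff_odd, even_iff_two_dvd]
      exact fun h => h4 (mul_dvd_mul_left 2 h)
    · exact ⟨1, m, N_one ▸ le_top, one_dvd 2, ho, (one_mul m).symm⟩
  -- The exponent is k + 1 rather than k because d may be 2: the modulus must be divisible by 2^k d.
  have h1 : H (d * m : ℕ) ≤ N (d * m) ⊔ H (m * 2 ^ (k + 1) : ℕ) :=
    H_le_sup_of_coprime ((Nat.coprime_two_right.mpr hm).pow_right _) hd
  have hdvd : d * m ∣ m * 2 ^ (k + 1) := by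
    rw [mul_comm d]
    exact mul_dvd_mul_left m (hd2.trans (dvd_pow_self 2 k.succ_ne_zero))
  refine (sup_step hdvd h1 (H_le_sup_mul_odd (mul_ne_zero hm.pos.ne' (by positivity)) hodd)).trans
    (sup_le_sup_left (H_le_H_of_dvd (Nat.cast_dvd_cast ?_)) _)
  rw [show n * (m * 2 ^ (k + 1)) = 2 ^ k * n * (2 * m) by ring]
  exact mul_dvd_mul_left _ (mul_dvd_mul_right hd2 m)

/-! ### The stabilizer of `∞` in `H₅` -/

/-- The semigroup words in the matrices `(T S) ^ j S` with `1 ≤ j ≤ 4`, which are nonnegative up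
to sign. -/
inductive PosWord : H5 → Prop
  | one : PosWord 1
  | mul {P : H5} (j : ℕ) (h1 : 1 ≤ j) (h4 : j ≤ 4) (hP : PosWord P) :
      PosWord ((T * S) ^ j * S * P)

lemma exists_posWord (A : H5) :
    ∃ P b, PosWord P ∧ (A = P * S ^ b ∨ A = S * (P * S ^ b)) := by
  have hc : ∀ B, S * (S * B) = B * S ^ 2 := fun B => by
    rw [← mul_assoc, ← sq]
    exact S_sq_mem_center B
  have hT : T = (T * S) ^ 1 * S * S ^ 2 := by
    rw [pow_one, mul_assoc, mul_assoc, ← pow_succ', ← pow_succ', S_pow_four, mul_one]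
  have hTmul : ∀ P b, T * (P * S ^ b) = (T * S) ^ 1 * S * P * S ^ (2 + b) := fun P b => by
    nth_rw 1 [hT]
    rw [mul_assoc (_ * S) _ (P * _), ← mul_assoc (S ^ 2) P, (S_sq_mem_center P).eq, pow_add]
    simp only [mul_assoc]
  induction A using H5_induction with
  | one => exact ⟨1, 0, .one, by simp⟩
  | S_mul A hA =>
    obtain ⟨P, b, hP, rfl | rfl⟩ := hA
    · exact ⟨P, b, hP, Or.inr rfl⟩
    · exact ⟨P, b + 2, hP, Or.inl (by rw [hc, mul_assoc, ← pow_add])⟩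
  | T_mul A hA =>
    obtain ⟨P, b, hP, rfl | rfl⟩ := hA
    · exact ⟨_, 2 + b, .mul 1 le_rfl (by norm_num) hP, Or.inl (hTmul P b)⟩
    · cases hP with
      | one =>
        refine ⟨_, 2 + (b + 1), .mul 1 le_rfl (by norm_num) .one, Or.inl ?_⟩
        rw [← hTmul, one_mul, one_mul, pow_succ']
      | @mul P j h1 h4 hP =>
        have key : T * (S * ((T * S) ^ j * S * P * S ^ b))
            = (T * S) ^ (j + 1) * S * P * S ^ b := by
          rw [pow_succ']
          simp only [mul_assoc]
        rw [key]
        rcases h4.lt_or_eq with h | rfl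
        · exact ⟨_, b, .mul (j + 1) (by omega) (by omega) hP, Or.inl rfl⟩
        -- At j = 4 the block becomes (TS)⁵ = 1 and disappears.
        · exact ⟨P, b, hP, Or.inr (by rw [TS_pow_five, one_mul, mul_assoc])⟩

/-- Nonnegative matrices, with a condition that determines the triangular ones on the diagonal. -/
structure IsPos (M : Matrix (Fin 2) (Fin 2) ZLam) : Prop where
  pos₀ : 0 < M 0 0
  pos₁ : 0 < M 1 1
  nonneg₀ : 0 ≤ M 0 1
  nonneg₁ : 0 ≤ M 1 0
  eq₀ : M 1 0 = 0 → M 0 0 = 1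
  eq₁ : M 0 1 = 0 → M 1 1 = 1

lemma lamZ_pos : 0 < lamZ := lam_pos

lemma IsPos.mul_left {M : Matrix (Fin 2) (Fin 2) ZLam} (hM : IsPos M)
    {V : Matrix (Fin 2) (Fin 2) ZLam} (hV : V = !![1, lamZ; 0, 1] ∨ V = !![lamZ, lamZ; 1, lamZ] ∨
      V = !![lamZ, 1; lamZ, lamZ] ∨ V = !![1, 0; lamZ, 1]) : IsPos (V * M) := by
  have hl := lamZ_pos
  obtain ⟨h1, h2, h3, h4, h5, h6⟩ := hM
  have e1 : 0 < lamZ * M 0 0 := mul_pos hl h1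
  have e2 : 0 < lamZ * M 1 1 := mul_pos hl h2
  have e3 : 0 ≤ lamZ * M 0 1 := mul_nonneg hl.le h3
  have e4 : 0 ≤ lamZ * M 1 0 := mul_nonneg hl.le h4
  have hrow : ∀ i j, (V * M) i j = V i 0 * M 0 j + V i 1 * M 1 j := fun i j => by
    rw [Matrix.mul_apply, Fin.sum_univ_two]
  rcases hV with rfl | rfl | rfl | rfl <;> constructor <;> simp only [hrow] <;>
    simp only [Matrix.of_apply, Matrix.cons_val', Matrix.cons_val_zero, Matrix.cons_val_one,
      Matrix.cons_val_fin_one, one_mul, zero_mul, zero_add, add_zero]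
  case inl.eq₀ => exact fun h => by rw [h5 h, h, mul_zero, add_zero]
  case inr.inr.inr.eq₁ => exact fun h => by rw [h6 h, h, mul_zero, zero_add]
  all_goals first | positivity | exact fun h => absurd h (by positivity)

lemma PosWord.isPos {P : H5} (hP : PosWord P) :
    IsPos (toMat P) ∨ IsPos (-toMat P) := by
  induction hP with
  | one =>
    left
    rw [map_one]
    constructor <;> simp
  | @mul P j h1 h4 _ ih =>
    have hV : ∃ V, (V = !![1, lamZ; 0, 1] ∨ V = !![lamZ, lamZ; 1, lamZ] ∨
        V = !![lamZ, 1; lamZ, lamZ] ∨ V = !![1, 0; lamZ, 1]) ∧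
        (toMat ((T * S) ^ j * S) = V ∨ toMat ((T * S) ^ j * S) = -V) := by
      rw [map_mul, toMat_S]
      interval_cases j
      · exact ⟨_, Or.inl rfl, Or.inr (by simp [toMat_TS])⟩
      · exact ⟨_, Or.inr (Or.inl rfl), Or.inl (by simp [toMat_TS_pow_two])⟩
      · exact ⟨_, Or.inr (Or.inr (Or.inl rfl)), Or.inr (by simp [toMat_TS_pow_three])⟩
      · exact ⟨_, Or.inr (Or.inr (Or.inr rfl)), Or.inl (by simp [toMat_TS_pow_four])⟩
    obtain ⟨V, hV, h | h⟩ := hV <;> rw [map_mul _ (_ * S), h] <;> rcases ih with ih | ih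
    · exact Or.inl (ih.mul_left hV)
    · exact Or.inr (by simpa using ih.mul_left hV)
    · exact Or.inr (by simpa using ih.mul_left hV)
    · exact Or.inl (by simpa using ih.mul_left hV)

lemma toMat_S_pow (b : ℕ) : ∃ ε : ZLam, ε ^ 2 = 1 ∧
    (toMat (S ^ b) = ε • 1 ∨ toMat (S ^ b) = ε • !![0, 1; -1, 0]) := by
  obtain ⟨n, rfl | rfl⟩ := Nat.even_or_odd' b
  · exact ⟨(-1) ^ n, by simp [← pow_mul, mul_comm n], Or.inl (by
      rw [pow_mul, map_pow, toMat_S_sq, ← neg_one_smul ZLam 1, smul_pow, one_pow])⟩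
  · exact ⟨(-1) ^ n, by simp [← pow_mul, mul_comm n], Or.inr (by
      rw [pow_succ, pow_mul, map_mul, map_pow, toMat_S_sq, ← neg_one_smul ZLam 1, smul_pow,
        one_pow, smul_mul_assoc, one_mul, toMat_S])⟩

/-- The upper triangular elements of `H₅` have diagonal entries `± 1`. -/
lemma sq_eq_one_of_upperTriangular {A : H5} (hA : toMat A 1 0 = 0) : toMat A 0 0 ^ 2 = 1 := by
  obtain ⟨P, b, hP, h⟩ := exists_posWord A
  obtain ⟨M, δ, hδ, hPM, hM⟩ : ∃ M, ∃ δ : ZLam, δ ^ 2 = 1 ∧ toMat P = δ • M ∧ IsPos M := by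
    rcases hP.isPos with h | h
    · exact ⟨_, 1, by simp, by simp, h⟩
    · exact ⟨_, -1, by simp, by simp, h⟩
  obtain ⟨ε, hε, hS⟩ := toMat_S_pow b
  have hδ0 : δ ≠ 0 := by rintro rfl; simp at hδ
  have hε0 : ε ≠ 0 := by rintro rfl; simp at hε
  have h00 := hM.pos₀.ne'
  have h11 := hM.pos₁.ne'
  -- A is ± M, MS, SM or SMS. In the two middle cases the lower left entry is ± a diagonal entry of
  -- M, hence nonzero; the outer two are settled by `eq₀` and `eq₁`.
  rcases h with rfl | rfl <;> rcases hS with hS | hS <;>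
    simp only [map_mul, hPM, hS, toMat_S] at hA ⊢ <;>
    simp [Matrix.mul_apply, Fin.sum_univ_two, hδ0, hε0, h00, h11] at hA ⊢
  · rw [← sq_eq_one_iff, hM.eq₀ hA, mul_pow, mul_pow, hδ, hε]
    ring
  · rw [← sq_eq_one_iff, hM.eq₁ hA, mul_pow, mul_pow, hδ, hε]
    ring

/-- Diagonal entries ±1, rather than arbitrary units of ℤ[λ], make A equal to ± a translation. -/
lemma commute_T_of_upperTriangular {A : H5} (hA : toMat A 1 0 = 0) : Commute A T := by
  have h1 := sq_eq_one_of_upperTriangular hA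
  have h2 := det_toMat A
  rw [hA, mul_zero, sub_zero] at h2
  have h3 : toMat A 0 0 = toMat A 1 1 := by
    linear_combination (-toMat A 0 0) * h2 + toMat A 1 1 * h1
  refine toMat_injective ?_
  rw [map_mul, map_mul, toMat_T]
  refine Matrix.ext fun i j => ?_
  fin_cases i <;> fin_cases j <;> simp [Matrix.mul_apply, Fin.sum_univ_two, hA]
  linear_combination lamZ * h3

/-! ### Cusp widths -/

lemma toGL_apply (A : H5) (i j : Fin 2) : toGL A i j = (toMat A i j : ℝ) := rfl

lemma toGL_smul_infty {A : H5} :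
    toGL A • (OnePoint.infty : OnePoint ℝ) = OnePoint.infty ↔ toMat A 1 0 = 0 := by
  rw [OnePoint.smul_infty_eq_self_iff, toGL_apply]
  simp

lemma toGL_smul_of_mem_Z {A : H5} (hA : A ∈ Z) (x : OnePoint ℝ) : toGL A • x = x := by
  rcases mem_Z_iff.mp hA with rfl | rfl
  · simp
  · cases x with
    | infty => simp [-map_pow, toGL_smul_infty, toMat_S_sq]
    | coe c => simp [-map_pow, OnePoint.smul_some_eq_ite, toGL_apply, toMat_S_sq]

lemma eq_infty_of_T_pow_smul {w : ℕ} (hw : w ≠ 0) {x : OnePoint ℝ}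
    (hx : toGL (T ^ w) • x = x) : x = OnePoint.infty := by
  cases x with
  | infty => rfl
  | coe c =>
    have : (lamZ : ℝ) ≠ 0 := lam_pos.ne'
    simp [-map_pow, OnePoint.smul_some_eq_ite, toGL_apply, toMat_T_pow, hw, this] at hx

variable {K : Subgroup G5}

/-- For w ≠ 0, T^w fixes only ∞ and Z acts trivially, so a conjugate of T^w by g fixes only g∞. -/
lemma exists_conj_of_isConj {x : OnePoint ℝ} {w : ℕ} (hw : w ≠ 0) {A : H5} (hA : proj A ∈ K)
    (hx : toGL A • x = x) (hconj : IsConj (proj T ^ w) (proj A)) :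
    ∃ g : H5, x = toGL g • (OnePoint.infty : OnePoint ℝ) ∧ g * T ^ w * g⁻¹ ∈ K.comap proj := by
  obtain ⟨c, hc⟩ := isConj_iff.mp hconj
  obtain ⟨g, rfl⟩ := QuotientGroup.mk'_surjective Z c
  have hgA : proj (g * T ^ w * g⁻¹) = proj A := by
    rw [← hc]
    simp only [map_mul, map_pow, map_inv]
    rfl
  refine ⟨g, ?_, by rwa [Subgroup.mem_comap, hgA]⟩
  have hz : (g * T ^ w * g⁻¹)⁻¹ * A ∈ Z := QuotientGroup.eq.mp hgA
  have h1 : toGL (g * T ^ w * g⁻¹) • x = x := by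
    have := toGL_smul_of_mem_Z hz x
    rw [map_mul, mul_smul, hx, map_inv, inv_smul_eq_iff] at this
    exact this.symm
  rw [eq_comm, ← eq_inv_smul_iff, eq_comm]
  refine eq_infty_of_T_pow_smul hw ?_
  rw [map_mul, map_mul, mul_smul, mul_smul, map_inv, ← eq_inv_smul_iff] at h1
  exact h1

lemma mem_widthSet {g : H5} {w : ℕ} (hw : 0 < w) (h : g * T ^ w * g⁻¹ ∈ K.comap proj) :
    w ∈ {m : ℕ | 0 < m ∧ ∃ A : H5, proj A ∈ K ∧
      toGL A • (toGL g • (OnePoint.infty : OnePoint ℝ)) = toGL g • (OnePoint.infty : OnePoint ℝ) ∧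
      IsConj (proj T ^ m) (proj A)} := by
  refine ⟨hw, _, h, ?_, isConj_iff.mpr ⟨proj g, by simp only [map_mul, map_pow, map_inv]⟩⟩
  rw [← mul_smul, ← map_mul, inv_mul_cancel_right, map_mul, mul_smul,
    toGL_smul_infty.mpr (by simp [toMat_T_pow])]

lemma isCuspOf_of_conj_mem {g : H5} {w : ℕ} (hw : w ≠ 0) (h : g * T ^ w * g⁻¹ ∈ K.comap proj) :
    IsCuspOf K (toGL g • (OnePoint.infty : OnePoint ℝ)) := by
  refine ⟨toGL (g * T ^ w * g⁻¹), Subgroup.mem_map_of_mem _ h, ?_, ?_⟩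
  · rw [map_mul, map_mul, map_inv, GeneralLinearGroup.isParabolic_conj_iff,
      GeneralLinearGroup.isParabolic_iff_of_upperTriangular (by simp [-map_pow, toGL_apply, toMat_T_pow])]
    have : (lamZ : ℝ) ≠ 0 := lam_pos.ne'
    simp [-map_pow, toGL_apply, toMat_T_pow, hw, this]
  · rw [← mul_smul, ← map_mul, inv_mul_cancel_right, map_mul, mul_smul,
      toGL_smul_infty.mpr (by simp [toMat_T_pow])]

/-- The width provides some k with k∞ = g∞; then k⁻¹g is upper triangular and commutes with T^w, so
k may be replaced by g. -/
lemma conj_mem_of_isWidth {g : H5} {w : ℕ}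
    (h : IsWidth K (toGL g • (OnePoint.infty : OnePoint ℝ)) w) :
    g * T ^ w * g⁻¹ ∈ K.comap proj := by
  obtain ⟨⟨hw, A, hA, hx, hconj⟩, -⟩ := h
  obtain ⟨k, hk, hmem⟩ := exists_conj_of_isConj hw.ne' hA hx hconj
  have hstab : toMat (k⁻¹ * g) 1 0 = 0 := by
    rw [← toGL_smul_infty, map_mul, mul_smul, hk, ← mul_smul, ← map_mul, inv_mul_cancel, map_one,
      one_smul]
  have hcomm : k⁻¹ * g * T ^ w = T ^ w * (k⁻¹ * g) :=
    ((commute_T_of_upperTriangular hstab).pow_right w).eq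
  rw [show g * T ^ w * g⁻¹ = k * (k⁻¹ * g * T ^ w) * g⁻¹ by group, hcomm]
  convert hmem using 1
  group

lemma exists_forall_conj_mem (hK : K.FiniteIndex) :
    ∃ n : ℕ, 0 < n ∧ ∀ g : H5, g * T ^ n * g⁻¹ ∈ K.comap proj := by
  refine ⟨K.normalCore.index, Nat.pos_of_ne_zero Subgroup.FiniteIndex.index_ne_zero, fun g => ?_⟩
  have h := K.normalCore.pow_index_mem (proj T)
  have := K.normalCore_le (Subgroup.Normal.conj_mem inferInstance _ h (proj g))
  rw [Subgroup.mem_comap]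
  simpa only [map_mul, map_pow, map_inv] using this

lemma geometricLevel_mem (hK : K.FiniteIndex) : 0 < geometricLevel K ∧
    ∀ (x : OnePoint ℝ) (w : ℕ), IsCuspOf K x → IsWidth K x w → w ∣ geometricLevel K := by
  obtain ⟨n, hn, hmem⟩ := exists_forall_conj_mem hK
  refine Nat.sInf_mem (s := {n : ℕ | 0 < n ∧
    ∀ (x : OnePoint ℝ) (w : ℕ), IsCuspOf K x → IsWidth K x w → w ∣ n})
    -- All widths are at most n, so n! is a common multiple and the infimum is not the default 0.
    ⟨n.factorial, n.factorial_pos, fun x w _ hw => ?_⟩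
  obtain ⟨hw0, A, hA, hx, hconj⟩ := hw.1
  obtain ⟨g, rfl, -⟩ := exists_conj_of_isConj hw0.ne' hA hx hconj
  exact Nat.dvd_factorial hw0 (hw.2 (mem_widthSet hn (hmem g)))

lemma conj_T_pow_geometricLevel_mem (hK : K.FiniteIndex) (g : H5) :
    g * T ^ geometricLevel K * g⁻¹ ∈ K.comap proj := by
  obtain ⟨n, hn, hmem⟩ := exists_forall_conj_mem hK
  have hw := isLeast_csInf (⟨n, mem_widthSet hn (hmem g)⟩ : Set.Nonempty _)
  obtain ⟨k, hk⟩ := (geometricLevel_mem hK).2 _ _ (isCuspOf_of_conj_mem hn.ne' (hmem g)) hw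
  rw [hk, pow_mul, ← conj_pow]
  exact pow_mem (conj_mem_of_isWidth hw) k

lemma N_geometricLevel_le {K : Subgroup G5} (hK : K.FiniteIndex) :
    N (geometricLevel K) ≤ K.comap proj :=
  (N_le (K := (K.comap proj).normalCore) (conj_T_pow_geometricLevel_mem hK)).trans
    (Subgroup.normalCore_le _)

/-- If for every `n ≠ 0` the groups `N(m)` and `H(n M)` together contain `H(M)`, where `m` is the
geometric level of `K`, then `K` is a congruence subgroup if and only if it contains `G(M)`. -/
lemma isCongruence_iff {K : Subgroup G5} (hK : K.FiniteIndex) {M : ℕ} (hM : M ≠ 0)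
    (h : ∀ n : ℕ, n ≠ 0 → H M ≤ N (geometricLevel K) ⊔ H (n * M : ℕ)) :
    IsCongruence K ↔ G M ≤ K := by
  refine ⟨?_, fun hG => ⟨M, Nat.cast_ne_zero.mpr hM, hG⟩⟩
  rintro ⟨π, hπ, hG⟩
  obtain ⟨n, hn, hdvd⟩ := exists_natCast_dvd hπ
  refine Subgroup.map_le_iff_le_comap.mpr ((h n hn).trans
    (sup_le (N_geometricLevel_le hK) (le_trans (H_le_H_of_dvd ?_)
      (Subgroup.map_le_iff_le_comap.mp hG))))
  rw [Nat.cast_mul]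
  exact hdvd.mul_right _

end HeckeFive
end

theorem proposition5p1 (K : Subgroup HeckeFive.G5) (hK : K.FiniteIndex) (m : ℕ)
    (hm : HeckeFive.geometricLevel K = m) :
    (¬ 4 ∣ m → (HeckeFive.IsCongruence K ↔ HeckeFive.G (m : HeckeFive.ZLam) ≤ K)) ∧
      (4 ∣ m → (HeckeFive.IsCongruence K ↔ HeckeFive.G (2 * (m : HeckeFive.ZLam)) ≤ K)) := by
  subst hm
  have h0 := (HeckeFive.geometricLevel_mem hK).1.ne'
  refine ⟨fun h4 => HeckeFive.isCongruence_iff hK h0 fun n hn => HeckeFive.H_le_sup_mul h4 hn,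
    fun h4 => ?_⟩
  have := HeckeFive.isCongruence_iff hK (mul_ne_zero two_ne_zero h0) fun n hn =>
    HeckeFive.H_two_mul_le_sup_mul h0 (dvd_trans (by norm_num) h4) hn
  simpa using this
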